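/- Let $p$ be an odd prime and let $x\in\mathbb{Z}_p$ be a $p$-adic integer. Let $\langle x\rangle_p\in\{0,1,\dots,p-1\}$ be the least nonnegative residue of $x$ modulo $p$ and write $x=\langle x\rangle_p+pt$ with $t\in\mathbb{Z}_p$. Put $\binom{y}{k}=y(y-1)\cdots(y-k+1)/k!$, and let $E_n(y)$ be the Euler polynomials, defined by $$\frac{2e^{yz}}{e^z+1}=\sum_{n=0}^{\infty}E_n(y)\frac{z^n}{n!}.$$ Congruences modulo $p^2$ are in $\mathbb{Q}_p$: $a\equiv b\pmod{p^2}$ means $a-b\in p^2\mathbb{Z}_p$. Then $$\sum_{k=0}^{p-1}\frac{\binom{x}{k}\binom{x+k}{k}(-4)^k}{\binom{2k}{k}}\equiv(-1)^{\langle x\rangle_p}(2t+1)(2x+1)-4pt(t+1)-2pt(t+1)(2x+1)E_{p-2}(-x)\pmod{p^2}.$$ Moreover, if $x\not\equiv 0,-1\pmod p$, then $$2x(x+1)\sum_{k=0}^{p-2}\frac{\binom{x}{k}\binom{x+k}{k}(-4)^k}{(k+1)\binom{2k}{k}}\equiv\sum_{k=0}^{p-1}\frac{\binom{x}{k}\binom{x+k}{k}(-4)^k}{\binom{2k}{k}}-1-\frac{2pt(t+1)}{x(x+1)}\pmod{p^2}.$$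 -/

import Mathlib

/-- The Euler polynomial `E_n(x)`: `n!` times the coefficient of `z ^ n` in the power series
`2 * e ^ (x * z) / (e ^ z + 1)` over `ℚ[x]`. -/
noncomputable def eulerPoly (n : ℕ) : Polynomial ℚ :=
  (n.factorial : Polynomial ℚ) *
    PowerSeries.coeff n
      (2 * PowerSeries.rescale Polynomial.X (PowerSeries.exp (Polynomial ℚ)) *
        PowerSeries.map Polynomial.C ((PowerSeries.exp ℚ + 1)⁻¹))

/-- Generating function: `(∑ E_n(x) z ^ n / n!) * (e ^ z + 1) = 2 * e ^ (x * z)`. -/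
theorem eulerPoly_generating :
    PowerSeries.mk (fun n => ((n.factorial : ℚ)⁻¹) • eulerPoly n) *
        (PowerSeries.exp (Polynomial ℚ) + 1) =
      2 * PowerSeries.rescale Polynomial.X (PowerSeries.exp (Polynomial ℚ)) := by
  have h1 : PowerSeries.mk (fun n => ((n.factorial : ℚ)⁻¹) • eulerPoly n) =
      2 * PowerSeries.rescale Polynomial.X (PowerSeries.exp (Polynomial ℚ)) *
        PowerSeries.map Polynomial.C ((PowerSeries.exp ℚ + 1)⁻¹) := by
    ext1 n
    have hn : (n.factorial : ℚ) ≠ 0 := by exact_mod_cast n.factorial_ne_zero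
    rw [PowerSeries.coeff_mk, eulerPoly, ← nsmul_eq_mul, ← Nat.cast_smul_eq_nsmul ℚ,
      smul_smul, inv_mul_cancel₀ hn, one_smul]
  have h2 : PowerSeries.exp (Polynomial ℚ) + 1 =
      PowerSeries.map Polynomial.C (PowerSeries.exp ℚ + 1) := by
    rw [map_add, map_one, PowerSeries.map_exp]
  have h3 : PowerSeries.constantCoeff (PowerSeries.exp ℚ + 1) ≠ 0 := by
    rw [map_add, map_one, PowerSeries.constantCoeff_exp]; norm_num
  rw [h1, h2, mul_assoc, ← map_mul, PowerSeries.inv_mul_cancel _ h3, map_one, mul_one]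

/-- Congruence modulo `p ^ n` in `ℚ_p`: the difference lies in `p ^ n ℤ_p`. -/
def PadicCongr (p : ℕ) [Fact p.Prime] (n : ℕ) (a b : ℚ_[p]) : Prop :=
  ∃ z : ℤ_[p], a - b = (p : ℚ_[p]) ^ n * (z : ℚ_[p])

/-! Since C(x,k) C(x+k,k) = C(x+k,2k) C(2k,k), the sum is S(x) = ∑_{k<p} T_k(x) with T_k(x) = (-4)^k
C(x+k,2k). The second difference of T_{k+1} in x is -4 T_k, so S(x+1) + 2S(x) + S(x-1) telescopes to
4 T_{p-1}(x) (`chooseSum_recurrence`). Fix t and let a run over the residues. At interior residues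
x(x+1) T_{p-1}(x) ≡ -pt(t+1) mod p² (`last_chooseTerm_congr`), and the functional equation of the
Euler polynomials makes the claimed value satisfy the same recurrence mod p². The error is then
(-1)^a times a linear function of a, and it vanishes once it does so at a = 0 and a = p-1
(`dvd_of_second_difference`). At a = 0, S(pt) is quadratic in t mod p² and is found by interpolation
(`chooseSum_prime_mul_congr`); it meets the claim through p E_{p-2}(0) ≡ 2 - 2^p. The reflection x ↦
-1-x carries a = p-1 to a = 0. The second congruence is an exact telescoping identity
(`two_mul_sum_chooseTerm_div`) plus the value of T_{p-1} mod p². -/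

/-! ### Exact identities for the truncated sums -/

section ChooseSum

variable {R : Type*} [CommRing R] [BinomialRing R]

/-- The `k`-th summand `(-4) ^ k * (x + k choose 2 k)`. -/
noncomputable def chooseTerm (x : R) (k : ℕ) : R :=
  (-4) ^ k * Ring.choose (x + k) (2 * k)

/-- The truncated sum `∑_{k < N} (-4) ^ k * (x + k choose 2 k)`. -/
noncomputable def chooseSum (N : ℕ) (x : R) : R :=
  ∑ k ∈ Finset.range N, chooseTerm x k

theorem chooseTerm_zero (x : R) : chooseTerm x 0 = 1 := by
  simp [chooseTerm]

theorem factorial_mul_choose (x : R) (k : ℕ) :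
    (k.factorial : R) * Ring.choose x k = ∏ j ∈ Finset.range k, (x - j) := by
  have h := Ring.descPochhammer_eq_factorial_smul_choose x k
  rw [nsmul_eq_mul] at h
  rw [← h]
  clear h
  induction k with
  | zero => simp
  | succ k ih =>
    rw [Finset.prod_range_succ, ← ih, descPochhammer_succ_right, Polynomial.smeval_mul,
      Polynomial.smeval_sub, Polynomial.smeval_X, Polynomial.smeval_natCast]
    simp

/-- Pair the factors symmetrically: (x - j)(x + j + 1) = x(x+1) - j(j+1). Only x(x+1) survives,
whence the symmetry x ↦ -1-x. -/
theorem prod_range_sub_eq {A : Type*} [CommRing A] (x : A) (k : ℕ) :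
    ∏ j ∈ Finset.range (2 * k), (x + k - j) =
      ∏ j ∈ Finset.range k, (x * (x + 1) - j * (j + 1)) := by
  induction k with
  | zero => simp
  | succ k ih =>
    rw [show 2 * (k + 1) = 2 * k + 1 + 1 by ring, Finset.prod_range_succ, Finset.prod_range_succ',
      Finset.prod_range_succ, ← ih]
    have : ∀ j ∈ Finset.range (2 * k), x + ((k + 1 : ℕ) : A) - ((j + 1 : ℕ) : A) = x + k - j := by
      intro j _
      push_cast
      ring
    rw [Finset.prod_congr rfl this]
    push_cast
    ring

theorem factorial_mul_choose_two_mul (x : R) (k : ℕ) :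
    ((2 * k).factorial : R) * Ring.choose (x + k) (2 * k) =
      ∏ j ∈ Finset.range k, (x * (x + 1) - j * (j + 1)) := by
  rw [factorial_mul_choose, prod_range_sub_eq]

section Domain

variable [IsDomain R] [CharZero R]

theorem chooseTerm_neg_one_sub (x : R) (k : ℕ) : chooseTerm (-1 - x) k = chooseTerm x k := by
  have h0 : ((2 * k).factorial : R) ≠ 0 := by exact_mod_cast (2 * k).factorial_ne_zero
  rw [chooseTerm, chooseTerm]
  congr 1
  apply mul_left_cancel₀ h0
  rw [factorial_mul_choose_two_mul, factorial_mul_choose_two_mul]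
  refine Finset.prod_congr rfl fun j _ => ?_
  ring

theorem chooseSum_neg_one_sub (N : ℕ) (x : R) : chooseSum N (-1 - x) = chooseSum N x :=
  Finset.sum_congr rfl fun k _ => chooseTerm_neg_one_sub x k

theorem choose_two_mul_succ (x : R) (k : ℕ) :
    (2 * k + 1) * (2 * k + 2) * Ring.choose (x + (k + 1 : ℕ)) (2 * (k + 1)) =
      (x * (x + 1) - k * (k + 1)) * Ring.choose (x + k) (2 * k) := by
  have h0 : ((2 * k).factorial : R) ≠ 0 := by exact_mod_cast (2 * k).factorial_ne_zero
  apply mul_left_cancel₀ h0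
  have h1 := factorial_mul_choose_two_mul x k
  have h2 := factorial_mul_choose_two_mul x (k + 1)
  rw [Finset.prod_range_succ, ← h1, show 2 * (k + 1) = 2 * k + 1 + 1 by ring,
    Nat.factorial_succ, Nat.factorial_succ] at h2
  rw [show 2 * (k + 1) = 2 * k + 1 + 1 by ring]
  push_cast at h2 ⊢
  linear_combination h2

theorem chooseTerm_succ (x : R) (k : ℕ) :
    (k + 1) * (2 * k + 1) * chooseTerm x (k + 1) =
      -2 * (x * (x + 1) - k * (k + 1)) * chooseTerm x k := by
  have h := choose_two_mul_succ x k
  apply mul_left_cancel₀ (two_ne_zero (α := R))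
  simp only [chooseTerm, pow_succ]
  linear_combination (-4) ^ k * (-4) * h

end Domain

theorem choose_second_difference (x : R) (k : ℕ) :
    Ring.choose (x + 1 + (k + 1 : ℕ)) (2 * (k + 1)) - 2 * Ring.choose (x + (k + 1 : ℕ)) (2 * (k + 1))
      + Ring.choose (x - 1 + (k + 1 : ℕ)) (2 * (k + 1)) = Ring.choose (x + k) (2 * k) := by
  have h1 := Ring.choose_succ_succ (x + (k + 1 : ℕ)) (2 * k + 1)
  have h2 := Ring.choose_succ_succ (x + k) (2 * k + 1)
  have h3 := Ring.choose_succ_succ (x + k) (2 * k)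
  rw [show x + 1 + ((k + 1 : ℕ) : R) = x + (k + 1 : ℕ) + 1 by ring,
    show x - 1 + ((k + 1 : ℕ) : R) = x + k by push_cast; ring,
    show 2 * (k + 1) = 2 * k + 1 + 1 by ring, h1]
  rw [show x + ((k + 1 : ℕ) : R) = x + k + 1 by push_cast; ring, h2, h3]
  ring

/-- The left side is the second difference plus 4S; each T_{k+1} contributes -4 T_k to the former,
so only the top term remains. -/
theorem chooseSum_recurrence (N : ℕ) (x : R) :
    chooseSum (N + 1) (x + 1) + 2 * chooseSum (N + 1) x + chooseSum (N + 1) (x - 1) =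
      4 * chooseTerm x N := by
  induction N with
  | zero => simp [chooseSum, chooseTerm_zero]; norm_num
  | succ N ih =>
    have h := choose_second_difference x N
    simp only [chooseSum, Finset.sum_range_succ _ (N + 1)] at ih ⊢
    simp only [chooseTerm, pow_succ] at ih ⊢
    linear_combination ih + (-4) ^ N * (-4) * h

theorem chooseTerm_natCast_of_lt {n k : ℕ} (h : n < k) : chooseTerm (n : R) k = 0 := by
  rw [chooseTerm, ← Nat.cast_add, Ring.choose_natCast, Nat.choose_eq_zero_of_lt (by omega)]
  simp

section Nat

variable [IsDomain R] [CharZero R]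

/-- The source 4 T_N vanishes at integers 0 ≤ n < N, leaving a homogeneous recurrence; S(-1) = S(0)
= 1 starts it. -/
theorem chooseSum_natCast (N n : ℕ) (h : n ≤ N) :
    chooseSum (N + 1) (n : R) = (-1) ^ n * (2 * n + 1) := by
  induction n using Nat.strong_induction_on with
  | _ n ih =>
    have h0 : chooseSum (N + 1) (0 : R) = 1 := by
      rw [chooseSum, Finset.sum_range_succ', chooseTerm_zero, Finset.sum_eq_zero, zero_add]
      intro k _
      exact_mod_cast chooseTerm_natCast_of_lt (R := R) (Nat.succ_pos k)
    match n, ih with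
    | 0, _ => simp [h0]
    | 1, _ =>
      have h1 := chooseSum_recurrence N (0 : R)
      have h2 := chooseSum_neg_one_sub (N + 1) (0 : R)
      have h3 : chooseTerm (0 : R) N = 0 := by
        exact_mod_cast chooseTerm_natCast_of_lt (R := R) (show 0 < N by omega)
      rw [sub_zero] at h2
      rw [zero_sub, zero_add, h2, h0, h3] at h1
      push_cast
      linear_combination h1
    | n + 2, ih =>
      have h1 := chooseSum_recurrence N ((n + 1 : ℕ) : R)
      have h2 := ih (n + 1) (by omega) (by omega)
      have h3 := ih n (by omega) (by omega)
      rw [chooseTerm_natCast_of_lt (by omega), h2,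
        show ((n + 1 : ℕ) : R) - 1 = n by push_cast; ring, h3,
        show ((n + 1 : ℕ) : R) + 1 = (n + 2 : ℕ) by push_cast; ring] at h1
      rw [pow_succ, pow_succ] at *
      push_cast at *
      linear_combination h1

/-- One step further, the source is nonzero for the first time. With N + 2 = p this yields S(p). -/
theorem chooseSum_natCast_succ (N : ℕ) :
    chooseSum (N + 2) ((N + 2 : ℕ) : R) = (-4) ^ (N + 1) * 4 + (-1) ^ N * (2 * N + 5) := by
  have h1 := chooseSum_recurrence (N + 1) ((N + 1 : ℕ) : R)
  have h2 := chooseSum_natCast (R := R) (N + 1) (N + 1) le_rfl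
  have h3 := chooseSum_natCast (R := R) (N + 1) N (by omega)
  have h4 : chooseTerm ((N + 1 : ℕ) : R) (N + 1) = (-4) ^ (N + 1) := by
    rw [chooseTerm, ← Nat.cast_add, Ring.choose_natCast, ← two_mul, Nat.choose_self]
    simp
  rw [h4, h2, show ((N + 1 : ℕ) : R) - 1 = N by push_cast; ring, h3,
        show ((N + 1 : ℕ) : R) + 1 = (N + 2 : ℕ) by push_cast; ring] at h1
  rw [pow_succ _ N] at *
  push_cast at *
  linear_combination h1

/-- With f k = T_k/(k+1), the ratio of consecutive terms gives 2x(x+1) f k = 2k T_k - (2k+1)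
T_{k+1}, which telescopes. -/
theorem two_mul_sum_chooseTerm_div (N : ℕ) (x : R) (f : ℕ → R)
    (hf : ∀ k < N, (k + 1) * f k = chooseTerm x k) :
    2 * x * (x + 1) * ∑ k ∈ Finset.range N, f k =
      chooseSum (N + 1) x - 1 - 2 * N * chooseTerm x N := by
  induction N with
  | zero => simp [chooseSum, chooseTerm_zero]
  | succ N ih =>
    have h0 : ((N : R) + 1) ≠ 0 := by exact_mod_cast N.succ_ne_zero
    have h1 := ih fun k hk => hf k (by omega)
    have h2 := chooseTerm_succ x N
    have h3 := hf N (by omega)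
    rw [Finset.sum_range_succ, mul_add, h1]
    simp only [chooseSum, Finset.sum_range_succ _ (N + 1)]
    apply mul_left_cancel₀ h0
    push_cast
    rw [← h3] at h2 ⊢
    linear_combination h2

end Nat

end ChooseSum

/-! ### Euler polynomials and their p-integrality -/

open Polynomial in
theorem eulerPoly_comp_X_add_one (n : ℕ) :
    (eulerPoly n).comp (X + 1) + eulerPoly n = 2 * X ^ n := by
  have hn : (n.factorial : ℚ[X]) ≠ 0 := by exact_mod_cast n.factorial_ne_zero
  have h3 : PowerSeries.constantCoeff (PowerSeries.exp ℚ + 1) ≠ 0 := by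
    rw [map_add, map_one, PowerSeries.constantCoeff_exp]; norm_num
  set H : PowerSeries ℚ[X] := PowerSeries.map C ((PowerSeries.exp ℚ + 1)⁻¹) with hH
  set E : PowerSeries ℚ[X] := PowerSeries.rescale X (PowerSeries.exp ℚ[X]) with hE
  have hinv : (PowerSeries.exp ℚ[X] + 1) * H = 1 := by
    rw [show PowerSeries.exp ℚ[X] + 1 = PowerSeries.map C (PowerSeries.exp ℚ + 1) by
      rw [map_add, map_one, PowerSeries.map_exp], hH, ← map_mul, PowerSeries.mul_inv_cancel _ h3,
      map_one]
  let φ : ℚ[X] →+* ℚ[X] := compRingHom (X + 1)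
  have hφH : PowerSeries.map φ H = H := by
    ext1 m
    simp [hH, φ]
  -- Shifting the variable by 1 multiplies e^{Xz} by e^z, and the sum of the two copies cancels the
  -- denominator e^z + 1.
  have hφE : PowerSeries.map φ E = E * PowerSeries.exp ℚ[X] := by
    have h := PowerSeries.exp_mul_exp_eq_exp_add (X : ℚ[X]) 1
    rw [PowerSeries.rescale_one, RingHom.id_apply] at h
    rw [hE, h]
    ext1 m
    simp [φ, PowerSeries.coeff_rescale, PowerSeries.coeff_exp]
    ring
  have hcomp : (eulerPoly n).comp (X + 1) = φ (eulerPoly n) := rfl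
  have hcoeff := congrArg (PowerSeries.coeff n)
    (show PowerSeries.map φ (2 * E * H) + 2 * E * H = 2 * E by
      rw [map_mul, map_mul, hφH, hφE, map_ofNat]
      linear_combination 2 * E * hinv)
  rw [map_add, PowerSeries.coeff_map] at hcoeff
  rw [hcomp, eulerPoly, map_mul, map_natCast, ← mul_add, hcoeff,
    ← map_ofNat (PowerSeries.C (R := ℚ[X])) 2, PowerSeries.coeff_C_mul, hE,
    PowerSeries.coeff_rescale, PowerSeries.coeff_exp]
  rw [show algebraMap ℚ ℚ[X] (1 / n.factorial) = C (1 / (n.factorial : ℚ)) from rfl]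
  have : (n.factorial : ℚ[X]) * C (1 / (n.factorial : ℚ)) = 1 := by
    rw [← C_eq_natCast, ← C_mul, mul_one_div_cancel (by exact_mod_cast n.factorial_ne_zero), C_1]
  linear_combination 2 * X ^ n * this

-- A recursion whose only division is by 2, a unit in ℤ_p for odd p.
open Polynomial in
theorem two_mul_eulerPoly (n : ℕ) :
    2 * eulerPoly n = 2 * X ^ n - ∑ i ∈ Finset.range n, (n.choose i : ℚ[X]) * eulerPoly i := by
  have hn : (n.factorial : ℚ) ≠ 0 := by exact_mod_cast n.factorial_ne_zero
  have h := congrArg (PowerSeries.coeff n) eulerPoly_generating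
  rw [mul_add, mul_one, map_add, PowerSeries.coeff_mul,
    ← map_ofNat (PowerSeries.C (R := ℚ[X])) 2, PowerSeries.coeff_C_mul,
    PowerSeries.coeff_rescale, PowerSeries.coeff_exp, PowerSeries.coeff_mk,
    Finset.Nat.sum_antidiagonal_eq_sum_range_succ_mk, Finset.sum_range_succ] at h
  simp only [PowerSeries.coeff_mk, PowerSeries.coeff_exp] at h
  replace h := congrArg (fun q : ℚ[X] => (n.factorial : ℚ) • q) h
  simp only [smul_add, Finset.smul_sum] at h
  have hsum : ∀ i ∈ Finset.range n, (n.factorial : ℚ) • ((i.factorial : ℚ)⁻¹ • eulerPoly i *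
      algebraMap ℚ ℚ[X] (1 / (n - i).factorial)) = (n.choose i : ℚ[X]) * eulerPoly i := by
    intro i hi
    have hi' : i ≤ n := (Finset.mem_range.mp hi).le
    rw [mul_comm _ (algebraMap _ _ _), ← Algebra.smul_def, smul_smul, smul_smul,
      ← C_eq_natCast, ← smul_eq_C_mul, Nat.cast_choose ℚ hi']
    congr 1
    ring
  rw [Finset.sum_congr rfl hsum] at h
  simp only [Nat.sub_self, Nat.factorial_zero, Nat.cast_one, div_one, map_one, mul_one,
    smul_smul, mul_inv_cancel₀ hn, one_smul] at h
  have h2 : (n.factorial : ℚ) • (2 * (X ^ n * algebraMap ℚ ℚ[X] (1 / (n.factorial : ℚ)))) =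
      2 * X ^ n := by
    rw [← mul_assoc, mul_comm _ (algebraMap _ _ _), ← Algebra.smul_def, smul_smul,
      mul_one_div_cancel hn, one_smul]
  rw [h2] at h
  linear_combination h

theorem PadicInt.isUnit_two {p : ℕ} [Fact p.Prime] (hp : Odd p) : IsUnit (2 : ℤ_[p]) := by
  have : IsUnit ((2 : ℕ) : ℤ_[p]) := by
    rw [PadicInt.isUnit_iff, PadicInt.norm_natCast_eq_one_iff]
    exact hp.coprime_two_right
  exact_mod_cast this

open Polynomial in
/-- For odd `p` the Euler polynomials have `p`-integral coefficients. -/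
theorem exists_map_eq_eulerPoly {p : ℕ} [Fact p.Prime] (hp : Odd p) (n : ℕ) :
    ∃ e : ℤ_[p][X], e.map PadicInt.Coe.ringHom = (eulerPoly n).map (algebraMap ℚ ℚ_[p]) := by
  obtain ⟨u, hu⟩ := (PadicInt.isUnit_two hp).exists_left_inv
  rw [← mem_lifts, lifts_iff_liftsRing]
  induction n using Nat.strong_induction_on with
  | _ n ih =>
    have h := congrArg (Polynomial.map (algebraMap ℚ ℚ_[p])) (two_mul_eulerPoly n)
    have hu' : C ((u : ℚ_[p])) * 2 = 1 := by
      rw [← map_ofNat (C : ℚ_[p] →+* ℚ_[p][X]) 2, ← C_mul]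
      rw [show (u : ℚ_[p]) * 2 = ((u * 2 : ℤ_[p]) : ℚ_[p]) by push_cast; rfl, hu]
      simp
    have h2 : (eulerPoly n).map (algebraMap ℚ ℚ_[p]) = C (u : ℚ_[p]) * (2 * X ^ n -
        ∑ i ∈ Finset.range n, (n.choose i : ℚ_[p][X]) *
          (eulerPoly i).map (algebraMap ℚ ℚ_[p])) := by
      rw [← one_mul ((eulerPoly n).map _), ← hu']
      simp only [Polynomial.map_mul, Polynomial.map_sub, Polynomial.map_sum, Polynomial.map_pow,
        Polynomial.map_X, Polynomial.map_natCast, Polynomial.map_ofNat] at h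
      rw [mul_assoc, h]
    rw [h2]
    have hX : (X : ℚ_[p][X]) ∈ liftsRing PadicInt.Coe.ringHom :=
      (lifts_iff_liftsRing _ _).mp (X_mem_lifts _)
    have hC : C (u : ℚ_[p]) ∈ liftsRing PadicInt.Coe.ringHom :=
      (lifts_iff_liftsRing _ _).mp (C'_mem_lifts ⟨u, rfl⟩)
    refine mul_mem hC (sub_mem (mul_mem (ofNat_mem _ 2) (pow_mem hX n)) (sum_mem fun i hi => ?_))
    exact mul_mem (natCast_mem _ _) (ih i (Finset.mem_range.mp hi))

open Polynomial in
/-- A `p`-integral version of the functional equation of the Euler polynomials. -/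
theorem exists_padicInt_eulerPoly {p : ℕ} [Fact p.Prime] (hp : Odd p) (n : ℕ) :
    ∃ e : ℤ_[p][X], (∀ y : ℤ_[p], ((e.eval y : ℤ_[p]) : ℚ_[p]) = aeval (y : ℚ_[p]) (eulerPoly n)) ∧
      ∀ y : ℤ_[p], e.eval (y + 1) + e.eval y = 2 * y ^ n := by
  obtain ⟨e, he⟩ := exists_map_eq_eulerPoly hp n
  have heval : ∀ y : ℤ_[p], ((e.eval y : ℤ_[p]) : ℚ_[p]) = aeval (y : ℚ_[p]) (eulerPoly n) := by
    intro y
    rw [aeval_def, ← eval_map, ← he, eval_map]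
    exact (eval₂_at_apply PadicInt.Coe.ringHom y).symm
  refine ⟨e, heval, fun y => PadicInt.ext ?_⟩
  have h := congrArg (aeval (y : ℚ_[p])) (eulerPoly_comp_X_add_one n)
  rw [map_add, aeval_comp, map_mul, map_ofNat] at h
  have h2 : (((2 : ℤ_[p]) : ℚ_[p])) = 2 := map_ofNat PadicInt.Coe.ringHom 2
  push_cast
  rw [heval, heval, h2]
  simpa using h

/-! ### The Fermat quotient of 2 and the value at 0 of the Euler polynomial -/

section Congruences

variable {p : ℕ} [Fact p.Prime]

/-- Expand 2^p binomially: C(p,j) = (p/j) C(p-1,j-1) ≡ (p/j)(-1)^{j-1} mod p², and 1/j ≡ j^{p-2} mod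
p. -/
theorem two_pow_congr (hp : Odd p) :
    (p : ℤ) ^ 2 ∣ 2 ^ p - 2 + p * ∑ j ∈ Finset.range p, (-1) ^ j * (j : ℤ) ^ (p - 2) := by
  have hpp : p.Prime := Fact.out
  have h3 : 3 ≤ p := by
    have := hpp.two_le
    rcases hp with ⟨m, rfl⟩
    omega
  obtain ⟨q, rfl⟩ : ∃ q, p = q + 3 := ⟨p - 3, by omega⟩
  rw [show q + 3 - 2 = q + 1 by omega]
  have hsum : (2 : ℤ) ^ (q + 3) = ∑ j ∈ Finset.range (q + 2), ((q + 3).choose (j + 1) : ℤ) + 2 := by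
    have h := Nat.sum_range_choose (q + 3)
    rw [Finset.sum_range_succ, Finset.sum_range_succ', Nat.choose_self, Nat.choose_zero_right] at h
    have := congrArg (Nat.cast : ℕ → ℤ) h
    push_cast at this ⊢
    linarith
  rw [hsum, Finset.sum_range_succ' _ (q + 2)]
  simp only [Nat.cast_zero, zero_pow (Nat.succ_ne_zero q), mul_zero, add_zero, add_sub_cancel_right]
  rw [Finset.mul_sum, ← Finset.sum_add_distrib]
  refine Finset.dvd_sum fun j hj => ?_
  have hj' : j + 1 < q + 3 := by
    have := Finset.mem_range.mp hj
    omega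
  have hc : ((q + 3 : ℕ) : ℤ) ∣ ((q + 3).choose (j + 1) : ℤ) := by
    exact_mod_cast hpp.dvd_choose_self (Nat.succ_ne_zero j) hj'
  have hfermat : ((q + 3 : ℕ) : ℤ) ∣ ((j + 1 : ℕ) : ℤ) ^ (q + 2) - 1 := by
    rw [← ZMod.intCast_zmod_eq_zero_iff_dvd] at *
    push_cast
    rw [sub_eq_zero]
    have h0 : ((j + 1 : ℕ) : ZMod (q + 3)) ≠ 0 := by
      rw [Ne, ZMod.natCast_eq_zero_iff]
      exact Nat.not_dvd_of_pos_of_lt (Nat.succ_pos j) hj'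
    have := ZMod.pow_card_sub_one_eq_one h0
    exact_mod_cast this
  have hmul : ((q + 3).choose (j + 1) : ℤ) * (j + 1 : ℕ) = (q + 3 : ℕ) * (q + 2).choose j := by
    have := Nat.add_one_mul_choose_eq (q + 2) j
    exact_mod_cast this.symm
  have hcent : ((q + 3 : ℕ) : ℤ) ∣ ((q + 2).choose j : ℤ) - (-1) ^ j := by
    have hlow : ∀ i, i < q + 3 → ((q + 3 : ℕ) : ℤ) ∣ ((q + 2).choose i : ℤ) - (-1) ^ i := by
      intro i
      induction i with
      | zero => simp
      | succ i ih =>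
        intro hi
        have h1 := ih (by omega)
        have h2 : ((q + 3 : ℕ) : ℤ) ∣ ((q + 3).choose (i + 1) : ℤ) := by
          exact_mod_cast hpp.dvd_choose_self (Nat.succ_ne_zero i) hi
        have hpascal : ((q + 3).choose (i + 1) : ℤ) =
            (q + 2).choose i + (q + 2).choose (i + 1) := by
          exact_mod_cast Nat.choose_succ_succ (q + 2) i
        have h4 := dvd_sub h2 h1
        rwa [hpascal, show ∀ u v w : ℤ, u + v - (u - w) = v - -1 * w from fun u v w => by ring,
          ← pow_succ'] at h4
    exact hlow j (by omega)
  obtain ⟨a, ha⟩ := hc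
  obtain ⟨b, hb⟩ := hfermat
  obtain ⟨c, hc⟩ := hcent
  refine ⟨c * ((j + 1 : ℕ) : ℤ) ^ (q + 1) - a * b, ?_⟩
  have e1 : ((q + 3).choose (j + 1) : ℤ) * ((j + 1 : ℕ) : ℤ) ^ (q + 2) =
      (q + 3 : ℕ) * (q + 2).choose j * ((j + 1 : ℕ) : ℤ) ^ (q + 1) := by
    rw [← hmul]; ring
  rw [ha] at e1 ⊢
  rw [sub_eq_iff_eq_add.mp hb, sub_eq_iff_eq_add.mp hc] at e1
  rw [pow_succ (-1 : ℤ) j]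
  linear_combination e1

-- Iterating the functional equation from 0 to p and using e(p) ≡ e(0) mod p gives e(0) ≡ ∑ (-1)^j
-- j^{p-2} mod p, the sum in `two_pow_congr`.
open Polynomial in
theorem prime_mul_eval_zero_congr (hp : Odd p) (e : ℤ_[p][X])
    (he : ∀ y : ℤ_[p], e.eval (y + 1) + e.eval y = 2 * y ^ (p - 2)) :
    (p : ℤ_[p]) ^ 2 ∣ 2 ^ p - 2 + p * e.eval 0 := by
  have hsum : ∀ m : ℕ, (-1) ^ m * e.eval (m : ℤ_[p]) =
      e.eval 0 - 2 * ∑ j ∈ Finset.range m, (-1) ^ j * (j : ℤ_[p]) ^ (p - 2) := by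
    intro m
    induction m with
    | zero => simp
    | succ m ih =>
      have h := he m
      rw [Finset.sum_range_succ, pow_succ]
      push_cast
      linear_combination (-(-1) ^ m) * h + ih
  have h1 := hsum p
  rw [hp.neg_one_pow] at h1
  have h2 : (p : ℤ_[p]) ∣ e.eval (p : ℤ_[p]) - e.eval 0 := by
    simpa using sub_dvd_eval_sub (p : ℤ_[p]) 0 e
  obtain ⟨c, hc⟩ := h2
  obtain ⟨d, hd⟩ := map_dvd (Int.castRingHom ℤ_[p]) (two_pow_congr (p := p) hp)
  obtain ⟨u, hu⟩ := (PadicInt.isUnit_two hp).exists_left_inv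
  simp only [map_add, map_sub, map_mul, map_pow, map_sum, map_neg, map_one, map_natCast,
    map_ofNat] at hd
  refine ⟨d - u * c, ?_⟩
  linear_combination hd - u * p * h1 - u * p * hc +
    p * (∑ j ∈ Finset.range p, (-1) ^ j * (j : ℤ_[p]) ^ (p - 2) - e.eval 0) * hu

/-! ### The sum at multiples of p -/

theorem PadicInt.factorial_dvd_prime {k : ℕ} (hk : k < 2 * p) : (k.factorial : ℤ_[p]) ∣ p := by
  have hpp : p.Prime := Fact.out
  have h1 : ((2 * p - 1).factorial : ℤ_[p]) ∣ p := by
    have hval : padicValNat p (2 * p - 1).factorial = 1 := by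
      have h2 := padicValNat_factorial_mul_add (p := p) (n := p - 1) 1 (by have := hpp.pos; omega)
      rw [padicValNat_factorial_mul, mul_one] at h2
      rw [show 2 * p - 1 = p + (p - 1) by have := hpp.pos; omega, h2]
      simp
    obtain ⟨m, hm⟩ : p ∣ (2 * p - 1).factorial :=
      (hpp.dvd_factorial).mpr (by have := hpp.pos; omega)
    have hm' : ¬ p ∣ m := by
      rintro ⟨l, rfl⟩
      have : p ^ 2 ∣ (2 * p - 1).factorial := ⟨l, by rw [hm]; ring⟩
      rw [padicValNat_dvd_iff_le (Nat.factorial_ne_zero _), hval] at this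
      omega
    have hu : IsUnit (m : ℤ_[p]) := by
      rw [PadicInt.isUnit_iff, PadicInt.norm_natCast_eq_one_iff]
      exact (hpp.coprime_iff_not_dvd.mpr hm')
    obtain ⟨u, hu⟩ := hu.exists_right_inv
    refine ⟨u, ?_⟩
    rw [hm]
    push_cast
    linear_combination -p * hu
  refine dvd_trans ?_ h1
  exact_mod_cast Nat.cast_dvd_cast (α := ℤ_[p]) (Nat.factorial_dvd_factorial (by omega))

theorem prod_range_eq_mul (z : ℤ_[p]) (k : ℕ) :
    ∏ j ∈ Finset.range (k + 1), (z * (z + 1) - j * (j + 1)) =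
      z * (z + (k + 1)) * ∏ j ∈ Finset.range k, (z ^ 2 - ((j : ℤ_[p]) + 1) ^ 2) := by
  induction k with
  | zero => simp
  | succ k ih =>
    rw [Finset.prod_range_succ, ih, Finset.prod_range_succ]
    push_cast
    ring

theorem dvd_prod_sub_prod (z : ℤ_[p]) (k : ℕ) :
    z ^ 2 ∣ ∏ j ∈ Finset.range k, (z ^ 2 - ((j : ℤ_[p]) + 1) ^ 2) -
      ∏ j ∈ Finset.range k, (-((j : ℤ_[p]) + 1) ^ 2) := by
  induction k with
  | zero => simp
  | succ k ih =>
    obtain ⟨c, hc⟩ := ih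
    rw [Finset.prod_range_succ, Finset.prod_range_succ, sub_eq_iff_eq_add.mp hc]
    exact ⟨c * (z ^ 2 - ((k : ℤ_[p]) + 1) ^ 2) +
      ∏ j ∈ Finset.range k, (-((j : ℤ_[p]) + 1) ^ 2), by ring⟩

/-- For z = pt the product has a factor z, whose p pays for the division by (2k+2)!; the factors z²
- j² are -j² mod p². What is left is t times a linear polynomial in t. -/
theorem exists_quadratic_chooseTerm {k : ℕ} (hk : k + 1 < p) :
    ∃ α β : ℤ_[p], ∀ t : ℤ_[p],
      (p : ℤ_[p]) ^ 2 ∣ chooseTerm (p * t) (k + 1) - (α * t + β * t ^ 2) := by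
  obtain ⟨u, hu⟩ := PadicInt.factorial_dvd_prime (p := p) (k := 2 * (k + 1)) (by omega)
  set Q : ℤ_[p] := ∏ j ∈ Finset.range k, (-((j : ℤ_[p]) + 1) ^ 2) with hQ
  refine ⟨(-4) ^ (k + 1) * u * (k + 1) * Q, (-4) ^ (k + 1) * u * p * Q, fun t => ?_⟩
  have hfac : ((2 * (k + 1)).factorial : ℤ_[p]) ≠ 0 := by
    exact_mod_cast Nat.factorial_ne_zero _
  obtain ⟨w, hw⟩ := dvd_prod_sub_prod ((p : ℤ_[p]) * t) k
  have h := factorial_mul_choose_two_mul ((p : ℤ_[p]) * t) (k + 1)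
  rw [prod_range_eq_mul, sub_eq_iff_eq_add.mp hw, ← hQ] at h
  have h2 : Ring.choose ((p : ℤ_[p]) * t + (k + 1 : ℕ)) (2 * (k + 1)) =
      u * t * (p * t + (k + 1)) * ((p * t) ^ 2 * w + Q) := by
    apply mul_left_cancel₀ hfac
    rw [h]
    linear_combination t * (p * t + (k + 1)) * ((p * t) ^ 2 * w + Q) * hu
  rw [chooseTerm, h2]
  exact ⟨(-4) ^ (k + 1) * u * t * (p * t + (k + 1)) * t ^ 2 * w, by ring⟩

theorem exists_quadratic_chooseSum : ∃ α β : ℤ_[p], ∀ t : ℤ_[p],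
    (p : ℤ_[p]) ^ 2 ∣ chooseSum p (p * t) - (1 + α * t + β * t ^ 2) := by
  have h : ∀ N, N + 1 ≤ p → ∃ α β : ℤ_[p], ∀ t : ℤ_[p],
      (p : ℤ_[p]) ^ 2 ∣ chooseSum (N + 1) (p * t) - (1 + α * t + β * t ^ 2) := by
    intro N
    induction N with
    | zero => exact fun _ => ⟨0, 0, fun t => by simp [chooseSum, chooseTerm_zero]⟩
    | succ N ih =>
      intro hN
      obtain ⟨α, β, h⟩ := ih (by omega)
      obtain ⟨α', β', h'⟩ := exists_quadratic_chooseTerm (p := p) (k := N) (by omega)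
      refine ⟨α + α', β + β', fun t => ?_⟩
      have := dvd_add (h t) (h' t)
      rw [chooseSum, Finset.sum_range_succ, ← chooseSum]
      convert this using 1
      ring
  have hpos : 0 < p := (Fact.out : p.Prime).pos
  have := h (p - 1) (by omega)
  rwa [Nat.sub_add_cancel hpos] at this

theorem dvd_of_dvd_two_mul (hp : Odd p) {a z : ℤ_[p]} (h : a ∣ 2 * z) : a ∣ z :=
  (PadicInt.isUnit_two hp).dvd_mul_left.mp h

/-- Interpolation at t = 1 and t = -1, where S(-p) = S(p-1) by reflection. The power 4^p becomes
linear in 2^p because (2^p - 2)² ≡ 0 mod p². -/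
theorem chooseSum_prime_mul_congr (hp : Odd p) (t : ℤ_[p]) :
    (p : ℤ_[p]) ^ 2 ∣ chooseSum p (p * t) -
      (1 + (2 * 2 ^ p - 2 - 2 * p) * t + (2 * 2 ^ p - 4) * t ^ 2) := by
  have hpp : p.Prime := Fact.out
  obtain ⟨n, hn⟩ : ∃ n, p = n + 2 := ⟨p - 2, by have := hpp.two_le; omega⟩
  have hev : Even (n + 1) := by
    rw [hn] at hp
    grind
  have hodd : Odd n := by grind
  have hcast : (p : ℤ_[p]) = n + 2 := by exact_mod_cast congrArg (Nat.cast (R := ℤ_[p])) hn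
  obtain ⟨α, β, h⟩ := exists_quadratic_chooseSum (p := p)
  have hA : chooseSum p ((p : ℤ_[p]) * 1) = 4 ^ p - 2 * p - 1 := by
    have := chooseSum_natCast_succ (R := ℤ_[p]) n
    rw [← hn, hev.neg_pow, hodd.neg_one_pow] at this
    rw [mul_one, this, ← pow_succ, show n + 1 + 1 = p by omega]
    linear_combination 2 * hcast
  have hB : chooseSum p ((p : ℤ_[p]) * (-1)) = 2 * p - 1 := by
    have := chooseSum_natCast (R := ℤ_[p]) (n + 1) (n + 1) le_rfl
    rw [hev.neg_one_pow, ← chooseSum_neg_one_sub, show n + 1 + 1 = p by omega,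
      show (-1 : ℤ_[p]) - ((n + 1 : ℕ) : ℤ_[p]) = p * (-1) by
        push_cast; linear_combination hcast] at this
    rw [this]
    push_cast
    linear_combination (-2) * hcast
  have h1 := h 1
  have h2 := h (-1)
  rw [hA] at h1
  rw [hB] at h2
  have h4 : (p : ℤ_[p]) ^ 2 ∣ (2 ^ p - 2) ^ 2 := by
    apply pow_dvd_pow_of_dvd
    obtain ⟨d, hd⟩ := map_dvd (Int.castRingHom ℤ_[p]) (two_pow_congr (p := p) hp)
    simp only [map_add, map_sub, map_mul, map_pow, map_sum, map_neg, map_one, map_natCast,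
      map_ofNat] at hd
    exact ⟨p * d - ∑ j ∈ Finset.range p, (-1) ^ j * (j : ℤ_[p]) ^ (p - 2), by
      linear_combination hd⟩
  obtain ⟨c1, h1⟩ := h1
  obtain ⟨c2, h2⟩ := h2
  obtain ⟨c3, h3⟩ := h t
  obtain ⟨c4, h4⟩ := h4
  apply dvd_of_dvd_two_mul hp
  refine ⟨2 * c3 - t * (c1 - c2) - t ^ 2 * (c1 + c2) + (t + t ^ 2) * c4, ?_⟩
  rw [show (4 : ℤ_[p]) ^ p = (2 ^ p) ^ 2 by rw [← pow_mul, mul_comm, pow_mul]; norm_num] at h1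
  linear_combination 2 * h3 - t * (h1 - h2) - t ^ 2 * (h1 + h2) + (t + t ^ 2) * h4

/-! ### The last term modulo p² -/

/-- Lucas' theorem for natural t, extended by continuity and density of ℕ in ℤ_p. -/
theorem choose_add_two_mul_congr {a : ℕ} (ha : a < p) (t : ℤ_[p]) :
    (p : ℤ_[p]) ∣ Ring.choose (a + p * t + p) (2 * p) - Ring.choose (t + 1) 2 := by
  have hpp : p.Prime := Fact.out
  have hclosed : IsClosed {s : ℤ_[p] |
      Ring.choose (a + p * s + p) (2 * p) - Ring.choose (s + 1) 2 ∈
        Metric.closedBall (0 : ℤ_[p]) ((p : ℝ) ^ (-(1 : ℕ) : ℤ))} := by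
    refine Metric.isClosed_closedBall.preimage (Continuous.sub ?_ ?_)
    · exact (PadicInt.continuous_choose (2 * p)).comp (by fun_prop)
    · exact (PadicInt.continuous_choose 2).comp (by fun_prop)
  have key : ∀ s : ℤ_[p], (p : ℤ_[p]) ∣
      Ring.choose (a + p * s + p) (2 * p) - Ring.choose (s + 1) 2 ↔
      Ring.choose (a + p * s + p) (2 * p) - Ring.choose (s + 1) 2 ∈
        Metric.closedBall (0 : ℤ_[p]) ((p : ℝ) ^ (-(1 : ℕ) : ℤ)) := by
    intro s
    rw [mem_closedBall_zero_iff, PadicInt.norm_le_pow_iff_mem_span_pow, pow_one,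
      Ideal.mem_span_singleton]
  rw [key]
  refine PadicInt.denseRange_natCast.induction_on (p := fun s : ℤ_[p] =>
    Ring.choose (a + p * s + p) (2 * p) - Ring.choose (s + 1) 2 ∈
        Metric.closedBall (0 : ℤ_[p]) ((p : ℝ) ^ (-(1 : ℕ) : ℤ))) t hclosed fun n => ?_
  rw [← key]
  have hl := Choose.choose_modEq_choose_mod_mul_choose_div (p := p) (n := a + p * n + p)
    (k := 2 * p)
  rw [show a + p * n + p = a + p * (n + 1) by ring, Nat.add_mul_mod_self_left,
    Nat.mod_eq_of_lt ha, Nat.add_mul_div_left _ _ hpp.pos, Nat.div_eq_of_lt ha, zero_add,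
    Nat.mul_mod_left, Nat.choose_zero_right, Nat.mul_div_cancel _ hpp.pos] at hl
  have h2 := map_dvd (Int.castRingHom ℤ_[p]) hl.symm.dvd
  rw [show (a : ℤ_[p]) + p * (n : ℤ_[p]) + p = ((a + p * (n + 1) : ℕ) : ℤ_[p]) by push_cast; ring,
    show (n : ℤ_[p]) + 1 = ((n + 1 : ℕ) : ℤ_[p]) by push_cast; ring, Ring.choose_natCast,
    Ring.choose_natCast]
  simpa using h2

theorem PadicInt.isUnit_natCast_of_lt {a : ℕ} (h0 : 0 < a) (ha : a < p) : IsUnit (a : ℤ_[p]) := by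
  rw [PadicInt.isUnit_iff, PadicInt.norm_natCast_eq_one_iff]
  exact ((Fact.out : p.Prime).coprime_iff_not_dvd.mpr (Nat.not_dvd_of_pos_of_lt h0 ha))

theorem PadicInt.isUnit_of_dvd_sub {x y : ℤ_[p]} (hy : IsUnit y) (h : (p : ℤ_[p]) ∣ x - y) :
    IsUnit x := by
  by_contra hx
  rw [PadicInt.not_isUnit_iff, PadicInt.norm_lt_one_iff_dvd] at hx
  have hy' : (p : ℤ_[p]) ∣ y := (dvd_sub_right hx).mp h
  rw [← PadicInt.norm_lt_one_iff_dvd, ← PadicInt.not_isUnit_iff] at hy'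
  exact hy' hy

theorem four_pow_sub_one_congr (hp : Odd p) : (p : ℤ_[p]) ∣ 4 ^ (p - 1) - 1 := by
  have hpp : p.Prime := Fact.out
  have h := ZMod.pow_card_sub_one_eq_one (p := p) (a := 4) (by
    have : ((4 : ℕ) : ZMod p) ≠ 0 := by
      rw [Ne, ZMod.natCast_eq_zero_iff, show 4 = 2 ^ 2 by norm_num]
      intro h
      have := (Nat.prime_dvd_prime_iff_eq hpp Nat.prime_two).mp (hpp.dvd_of_dvd_pow h)
      subst this
      exact absurd hp (by decide)
    exact_mod_cast this)
  have h2 : (p : ℤ) ∣ 4 ^ (p - 1) - 1 := by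
    rw [← ZMod.intCast_zmod_eq_zero_iff_dvd]
    push_cast
    rw [h, sub_self]
  simpa using map_dvd (Int.castRingHom ℤ_[p]) h2

/-- The step from k = p-1 to k = p expresses T_{p-1} through 2p(2p-1) C(x+p,2p), which is needed
only mod p after the factor p. -/
theorem last_chooseTerm_congr (hp : Odd p) {a : ℕ} (h0 : 0 < a) (ha : a + 1 < p) (t : ℤ_[p]) :
    (p : ℤ_[p]) ^ 2 ∣ (a + p * t) * (a + p * t + 1) * chooseTerm (a + p * t) (p - 1) +
      p * t * (t + 1) := by
  have hpp : p.Prime := Fact.out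
  obtain ⟨n, hn⟩ : ∃ n, p = n + 1 := ⟨p - 1, by omega⟩
  have hn' : (n : ℤ_[p]) = p - 1 := by
    have : (p : ℤ_[p]) = n + 1 := by exact_mod_cast congrArg (Nat.cast (R := ℤ_[p])) hn
    linear_combination -this
  have hev : Even n := by
    rw [hn] at hp
    grind
  have hpn : p - 1 = n := by omega
  set x : ℤ_[p] := a + p * t with hx
  obtain ⟨w, hw⟩ := choose_add_two_mul_congr (show a < p by omega) t
  rw [← hx] at hw
  have hrec := choose_two_mul_succ x n
  rw [← hn, sub_eq_iff_eq_add.mp hw, hn'] at hrec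
  have hch : 2 * Ring.choose (t + 1) 2 = (t + 1) * t := by
    have := factorial_mul_choose (t + 1) 2
    simpa [Finset.prod_range_succ] using this
  obtain ⟨d, hd⟩ := four_pow_sub_one_congr (p := p) hp
  rw [hpn] at hd
  have hpow : (-4 : ℤ_[p]) ^ n = p * d + 1 := by
    rw [hev.neg_pow]
    linear_combination hd
  have hT : chooseTerm x (p - 1) = (p * d + 1) * Ring.choose (x + (p - 1)) (2 * n) := by
    rw [chooseTerm, hpn, hpow, hn']
  have h1 : (x * (x + 1) - (p - 1) * p) * chooseTerm x (p - 1) =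
      p * ((2 * p - 1) * (p * d + 1) * (2 * p * w + t * (t + 1))) := by
    rw [hT]
    linear_combination (p * d + 1) * (-hrec) + (p * d + 1) * p * (2 * p - 1) * hch
  have hu : IsUnit (x * (x + 1) - (p - 1) * p) := by
    refine PadicInt.isUnit_of_dvd_sub (y := ((a : ℕ) : ℤ_[p]) * ((a + 1 : ℕ) : ℤ_[p]))
      ((PadicInt.isUnit_natCast_of_lt h0 (by omega)).mul
        (PadicInt.isUnit_natCast_of_lt (by omega) ha)) ?_
    refine ⟨t * (2 * a + 1 + p * t) - (p - 1), ?_⟩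
    rw [hx]
    push_cast
    ring
  -- Divisibility of T_{p-1} by p lets the correction (p-1)p T_{p-1} drop out mod p².
  obtain ⟨g, hg⟩ : (p : ℤ_[p]) ∣ chooseTerm x (p - 1) := by
    rw [← hu.dvd_mul_left, h1]
    exact dvd_mul_right _ _
  refine ⟨(p - 1) * g + (2 * d * p - d + 2) * (t * (t + 1)) +
    (2 * p - 1) * (p * d + 1) * 2 * w, ?_⟩
  linear_combination h1 + (p - 1) * p * hg

end Congruences

/-! ### Induction on the residue -/

/-- Modulo m, (-1)^a D a has zero second difference and vanishes at 0, so it is linear in a;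
vanishing at n, a unit, kills the slope. -/
theorem dvd_of_second_difference {R : Type*} [CommRing R] {m : R} {n : ℕ} (D : ℕ → R)
    (h0 : m ∣ D 0) (hn : m ∣ D n) (hu : IsUnit (n : R))
    (hrec : ∀ a, a + 2 ≤ n → m ∣ D (a + 2) + 2 * D (a + 1) + D a) {a : ℕ} (ha : a ≤ n) :
    m ∣ D a := by
  have hlin : ∀ a, a ≤ n → m ∣ D a + (-1) ^ a * a * D 1 := by
    intro a
    induction a using Nat.strong_induction_on with
    | _ a ih =>
      match a, ih with
      | 0, _ => simpa using h0
      | 1, _ => simp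
      | a + 2, ih =>
        intro ha
        obtain ⟨c0, h0⟩ := ih a (by omega) (by omega)
        obtain ⟨c1, h1⟩ := ih (a + 1) (by omega) (by omega)
        obtain ⟨c2, h2⟩ := hrec a ha
        refine ⟨c2 - 2 * c1 - c0, ?_⟩
        rw [pow_succ, pow_succ] at *
        push_cast at *
        linear_combination h2 - 2 * h1 - h0
  have h1 : m ∣ D 1 := by
    have h2 := (dvd_add_right hn).mp (hlin n le_rfl)
    exact ((((isUnit_one.neg).pow n).mul hu).dvd_mul_left).mp h2
  have h3 : m ∣ (-1) ^ a * a * D 1 := h1.mul_left _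
  exact (dvd_add_left h3).mp (hlin a ha)

section Main

variable {p : ℕ} [Fact p.Prime]

theorem PadicInt.dvd_pow_sub_one {x : ℤ_[p]} (hx : IsUnit x) : (p : ℤ_[p]) ∣ x ^ (p - 1) - 1 := by
  have h0 : PadicInt.toZMod x ≠ 0 := (hx.map PadicInt.toZMod).ne_zero
  have h := ZMod.pow_card_sub_one_eq_one h0
  have hker : x ^ (p - 1) - 1 ∈ RingHom.ker (PadicInt.toZMod (p := p)) := by
    rw [RingHom.mem_ker, map_sub, map_pow, h, map_one, sub_self]
  rwa [PadicInt.ker_toZMod, PadicInt.maximalIdeal_eq_span_p, Ideal.mem_span_singleton] at hker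

theorem PadicInt.isUnit_natCast_add_mul {a : ℕ} (h0 : 0 < a) (ha : a < p) (t : ℤ_[p]) :
    IsUnit ((a : ℤ_[p]) + p * t) :=
  PadicInt.isUnit_of_dvd_sub (PadicInt.isUnit_natCast_of_lt h0 ha) ⟨t, by ring⟩

open Polynomial

/-- The value, modulo `p ^ 2`, of the truncated sum at `x = a + p * t`; the polynomial `e` stands
for the Euler polynomial of degree `p - 2`. -/
noncomputable def chooseSumValue (e : ℤ_[p][X]) (t : ℤ_[p]) (a : ℕ) : ℤ_[p] :=
  (-1) ^ a * (2 * t + 1) * (2 * (a + p * t) + 1) - 4 * p * t * (t + 1) -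
    2 * p * t * (t + 1) * (2 * (a + p * t) + 1) * e.eval (-(a + p * t))

theorem chooseSum_congr_zero (hp : Odd p) (e : ℤ_[p][X])
    (he : ∀ y : ℤ_[p], e.eval (y + 1) + e.eval y = 2 * y ^ (p - 2)) (t : ℤ_[p]) :
    (p : ℤ_[p]) ^ 2 ∣ chooseSum p (p * t) - chooseSumValue e t 0 := by
  obtain ⟨c, hc⟩ := chooseSum_prime_mul_congr hp t
  obtain ⟨d, hd⟩ := prime_mul_eval_zero_congr hp e he
  obtain ⟨w, hw⟩ : (p : ℤ_[p]) ∣ e.eval (-(p * t)) - e.eval 0 :=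
    dvd_trans ⟨-t, by ring⟩ (sub_dvd_eval_sub (-((p : ℤ_[p]) * t)) 0 e)
  refine ⟨c + 2 * t * (t + 1) * d + 4 * t ^ 2 * (t + 1) * e.eval 0 +
    2 * t * (t + 1) * (2 * p * t + 1) * w, ?_⟩
  simp only [chooseSumValue, pow_zero, Nat.cast_zero, zero_add]
  linear_combination hc + 2 * t * (t + 1) * hd + 2 * p * t * (t + 1) * (2 * p * t + 1) * hw

theorem chooseSum_congr_last (hp : Odd p) (e : ℤ_[p][X])
    (he : ∀ y : ℤ_[p], e.eval (y + 1) + e.eval y = 2 * y ^ (p - 2)) (t : ℤ_[p]) :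
    (p : ℤ_[p]) ^ 2 ∣ chooseSum p (((p - 1 : ℕ) : ℤ_[p]) + p * t) - chooseSumValue e t (p - 1) := by
  have hpp : p.Prime := Fact.out
  have h3 : p - 2 ≠ 0 := by
    have := hpp.two_le
    rcases hp with ⟨m, rfl⟩
    omega
  have hev : Even (p - 1) := by grind
  have hcast : ((p - 1 : ℕ) : ℤ_[p]) = p - 1 := by
    rw [Nat.cast_sub hpp.one_le, Nat.cast_one]
  -- The reflection sends p - 1 + pt to ps, and t(t+1) = s(s+1).
  obtain ⟨s, hs⟩ : ∃ s, t = -s - 1 := ⟨-t - 1, by ring⟩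
  obtain ⟨c, hc⟩ := chooseSum_congr_zero hp e he s
  obtain ⟨w, hw⟩ : (p : ℤ_[p]) ∣ e.eval (p * s) - e.eval (-(p * s)) :=
    dvd_trans ⟨2 * s, by ring⟩ (sub_dvd_eval_sub ((p : ℤ_[p]) * s) (-(p * s)) e)
  -- Hence e(ps+1) ≡ -e(ps) mod p; the exponent p - 2 is positive since p is odd.
  obtain ⟨v, hv⟩ : (p : ℤ_[p]) ∣ 2 * (p * s) ^ (p - 2) :=
    (dvd_pow (dvd_mul_right _ _) h3).mul_left _
  have hfun := he (p * s)
  rw [hv] at hfun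
  refine ⟨c + 2 * s * (s + 1) * (-(2 * p * s + 1)) * (v - w), ?_⟩
  rw [← chooseSum_neg_one_sub]
  simp only [chooseSumValue, pow_zero, Nat.cast_zero, zero_add, hev.neg_one_pow, hcast] at hc ⊢
  rw [hs, show -1 - ((p : ℤ_[p]) - 1 + p * (-s - 1)) = p * s by ring,
    show -((p : ℤ_[p]) - 1 + p * (-s - 1)) = p * s + 1 by ring]
  linear_combination hc - 2 * p * s * (s + 1) * (2 * p * s + 1) * (hfun - hw)

theorem chooseSum_congr_recurrence (hp : Odd p) (e : ℤ_[p][X])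
    (he : ∀ y : ℤ_[p], e.eval (y + 1) + e.eval y = 2 * y ^ (p - 2)) (t : ℤ_[p]) {a : ℕ}
    (ha : a + 2 < p) :
    (p : ℤ_[p]) ^ 2 ∣
      (chooseSum p (((a + 2 : ℕ) : ℤ_[p]) + p * t) - chooseSumValue e t (a + 2)) +
      2 * (chooseSum p (((a + 1 : ℕ) : ℤ_[p]) + p * t) - chooseSumValue e t (a + 1)) +
      (chooseSum p ((a : ℤ_[p]) + p * t) - chooseSumValue e t a) := by
  have hpp : p.Prime := Fact.out
  have hodd : Odd (p - 2) := by grind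
  obtain ⟨c, hc⟩ := last_chooseTerm_congr hp (Nat.succ_pos a) (show a + 1 + 1 < p by omega) t
  have hrec := chooseSum_recurrence (p - 1) (((a + 1 : ℕ) : ℤ_[p]) + p * t)
  rw [Nat.sub_add_cancel hpp.one_le] at hrec
  have hu0 := PadicInt.isUnit_natCast_add_mul (Nat.succ_pos a) (by omega) t
  have hu1 := PadicInt.isUnit_natCast_add_mul (Nat.succ_pos (a + 1)) (by omega) t
  obtain ⟨u0, h0⟩ := PadicInt.dvd_pow_sub_one hu0
  obtain ⟨u1, h1⟩ := PadicInt.dvd_pow_sub_one hu1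
  rw [show p - 1 = p - 2 + 1 by omega, pow_succ] at h0 h1
  simp only [chooseSumValue]
  set x : ℤ_[p] := ((a + 1 : ℕ) : ℤ_[p]) + p * t with hx
  have hx1 : ((a + 2 : ℕ) : ℤ_[p]) + p * t = x + 1 := by rw [hx]; push_cast; ring
  have hx0 : (a : ℤ_[p]) + p * t = x - 1 := by rw [hx]; push_cast; ring
  rw [show ((a + 1).succ : ℤ_[p]) + p * t = x + 1 by rw [hx]; push_cast; ring] at h1 hu1
  rw [hx1, hx0]
  have hf0 := he (-x)
  have hf1 := he (-(x + 1))
  rw [hodd.neg_pow, show -x + 1 = -(x - 1) by ring] at hf0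
  rw [hodd.neg_pow, show -(x + 1) + 1 = -x by ring] at hf1
  -- Multiplying by the unit x(x+1) clears the inverses that x^{p-2} and (x+1)^{p-2} represent mod
  -- p. The coefficients regroup by 2(2x+1) = (2x+3) + (2x-1), one functional equation for each
  -- summand.
  rw [← (hu0.mul hu1).dvd_mul_left, pow_succ, pow_succ]
  refine ⟨4 * c - 4 * t * (t + 1) * ((2 * x + 3) * x * u1 + (2 * x - 1) * (x + 1) * u0), ?_⟩
  linear_combination x * (x + 1) * hrec + 4 * hc +
    2 * p * t * (t + 1) * x * (x + 1) * ((2 * x + 3) * hf1 + (2 * x - 1) * hf0) -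
    4 * p * t * (t + 1) * ((2 * x + 3) * x * h1 + (2 * x - 1) * (x + 1) * h0)

theorem chooseSum_congr (hp : Odd p) (e : ℤ_[p][X])
    (he : ∀ y : ℤ_[p], e.eval (y + 1) + e.eval y = 2 * y ^ (p - 2)) (t : ℤ_[p]) {a : ℕ}
    (ha : a < p) :
    (p : ℤ_[p]) ^ 2 ∣ chooseSum p ((a : ℤ_[p]) + p * t) - chooseSumValue e t a := by
  have h2 := (Fact.out : p.Prime).two_le
  refine dvd_of_second_difference (n := p - 1)
    (fun a => chooseSum p ((a : ℤ_[p]) + p * t) - chooseSumValue e t a) ?_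
    (chooseSum_congr_last hp e he t) (PadicInt.isUnit_natCast_of_lt (by omega) (by omega))
    (fun a ha => chooseSum_congr_recurrence hp e he t (by omega)) (by omega)
  simpa using chooseSum_congr_zero hp e he t

/-! ### Transfer to ℚ_p and conclusion -/

theorem coe_chooseTerm (x : ℤ_[p]) (k : ℕ) :
    ((chooseTerm x k : ℤ_[p]) : ℚ_[p]) = chooseTerm (x : ℚ_[p]) k := by
  have h := Ring.map_choose PadicInt.Coe.ringHom (x + k) (2 * k)
  have h4 : ((-4 : ℤ_[p]) : ℚ_[p]) = -4 := by
    rw [PadicInt.coe_neg]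
    exact congrArg Neg.neg (map_ofNat PadicInt.Coe.ringHom 4)
  rw [map_add, map_natCast] at h
  rw [chooseTerm, chooseTerm, PadicInt.coe_mul, PadicInt.coe_pow, h4]
  exact congrArg _ h

theorem coe_chooseSum (N : ℕ) (x : ℤ_[p]) :
    ((chooseSum N x : ℤ_[p]) : ℚ_[p]) = chooseSum N (x : ℚ_[p]) := by
  rw [chooseSum, PadicInt.coe_sum]
  exact Finset.sum_congr rfl fun k _ => coe_chooseTerm x k

theorem chooseTerm_eq_div {K : Type*} [Field K] [CharZero K] [BinomialRing K] (x : K) (k : ℕ) :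
    Ring.choose x k * Ring.choose (x + k) k * (-4) ^ k / ((2 * k).choose k : K) =
      chooseTerm x k := by
  have h0 : ((2 * k).choose k : K) ≠ 0 := by
    exact_mod_cast (Nat.choose_pos (by omega)).ne'
  have h := Ring.choose_add_smul_choose x k k
  rw [nsmul_eq_mul, ← two_mul] at h
  rw [div_eq_iff h0, chooseTerm]
  linear_combination (-4) ^ k * (-h)

end Main

theorem padicCongr_of_dvd {p : ℕ} [Fact p.Prime] {n : ℕ} {a b : ℤ_[p]}
    (h : (p : ℤ_[p]) ^ n ∣ a - b) : PadicCongr p n a b := by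
  obtain ⟨z, hz⟩ := h
  refine ⟨z, ?_⟩
  rw [← PadicInt.coe_sub, hz]
  push_cast
  rfl

theorem corollary1p2 (p : ℕ) [Fact p.Prime] (hp : Odd p) (x t : ℤ_[p])
    (ht : x = (x.zmodRepr : ℤ_[p]) + (p : ℤ_[p]) * t) :
    PadicCongr p 2
      (∑ k ∈ Finset.range p,
        Ring.choose (x : ℚ_[p]) k * Ring.choose ((x : ℚ_[p]) + (k : ℚ_[p])) k *
          (-4 : ℚ_[p]) ^ k / (Nat.choose (2 * k) k : ℚ_[p]))
      ((-1 : ℚ_[p]) ^ x.zmodRepr * (2 * (t : ℚ_[p]) + 1) * (2 * (x : ℚ_[p]) + 1)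
        - 4 * (p : ℚ_[p]) * (t : ℚ_[p]) * ((t : ℚ_[p]) + 1)
        - 2 * (p : ℚ_[p]) * (t : ℚ_[p]) * ((t : ℚ_[p]) + 1) * (2 * (x : ℚ_[p]) + 1) *
          Polynomial.aeval (-(x : ℚ_[p])) (eulerPoly (p - 2))) ∧
    (¬ (p : ℤ_[p]) ∣ x → ¬ (p : ℤ_[p]) ∣ x + 1 →
      PadicCongr p 2
        (2 * (x : ℚ_[p]) * ((x : ℚ_[p]) + 1) *
          ∑ k ∈ Finset.range (p - 1),
            Ring.choose (x : ℚ_[p]) k * Ring.choose ((x : ℚ_[p]) + (k : ℚ_[p])) k *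
              (-4 : ℚ_[p]) ^ k / (((k : ℚ_[p]) + 1) * (Nat.choose (2 * k) k : ℚ_[p])))
        ((∑ k ∈ Finset.range p,
            Ring.choose (x : ℚ_[p]) k * Ring.choose ((x : ℚ_[p]) + (k : ℚ_[p])) k *
              (-4 : ℚ_[p]) ^ k / (Nat.choose (2 * k) k : ℚ_[p]))
          - 1
          - 2 * (p : ℚ_[p]) * (t : ℚ_[p]) * ((t : ℚ_[p]) + 1) /
            ((x : ℚ_[p]) * ((x : ℚ_[p]) + 1)))) := by

  have hlt : x.zmodRepr < p := x.zmodRepr_lt_p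
  obtain ⟨e, heval, he⟩ := exists_padicInt_eulerPoly hp (p - 2)
  have h2 : ((2 : ℤ_[p]) : ℚ_[p]) = 2 := map_ofNat PadicInt.Coe.ringHom 2
  have h4 : ((4 : ℤ_[p]) : ℚ_[p]) = 4 := map_ofNat PadicInt.Coe.ringHom 4
  have hsum : ∑ k ∈ Finset.range p,
      Ring.choose (x : ℚ_[p]) k * Ring.choose ((x : ℚ_[p]) + (k : ℚ_[p])) k *
        (-4 : ℚ_[p]) ^ k / (Nat.choose (2 * k) k : ℚ_[p]) = chooseSum p (x : ℚ_[p]) :=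
    Finset.sum_congr rfl fun k _ => chooseTerm_eq_div _ k
  rw [hsum]
  constructor
  · have h := padicCongr_of_dvd (chooseSum_congr hp e he t hlt)
    rw [chooseSumValue, ← ht, coe_chooseSum] at h
    push_cast at h
    rwa [heval, PadicInt.coe_neg, h2, h4] at h
  · intro hx0 hx1
    have ha0 : 0 < x.zmodRepr := by
      rw [Nat.pos_iff_ne_zero]
      intro h0
      apply hx0
      rw [h0, Nat.cast_zero, zero_add] at ht
      exact ⟨t, ht⟩
    have ha1 : x.zmodRepr + 1 < p := by
      by_contra hge
      have heq : x.zmodRepr + 1 = p := by omega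
      apply hx1
      have hc : (x.zmodRepr : ℤ_[p]) + 1 = p := by
        exact_mod_cast congrArg (Nat.cast (R := ℤ_[p])) heq
      exact ⟨1 + t, by linear_combination ht + hc⟩
    obtain ⟨c, hc⟩ := last_chooseTerm_congr hp ha0 ha1 t
    have hu0 := PadicInt.isUnit_natCast_add_mul ha0 hlt t
    have hu1 := PadicInt.isUnit_natCast_add_mul (Nat.succ_pos _) ha1 t
    rw [Nat.succ_eq_add_one, Nat.cast_add, Nat.cast_one, add_right_comm, ← ht] at hu1
    rw [← ht] at hu0 hc
    obtain ⟨v, hv⟩ := (hu0.mul hu1).exists_right_inv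
    have hpos : 1 ≤ p := by omega
    have hdiv := two_mul_sum_chooseTerm_div (p - 1) (x : ℚ_[p])
      (fun k => Ring.choose (x : ℚ_[p]) k * Ring.choose ((x : ℚ_[p]) + (k : ℚ_[p])) k *
              (-4 : ℚ_[p]) ^ k / (((k : ℚ_[p]) + 1) * (Nat.choose (2 * k) k : ℚ_[p]))) (by
        intro k _
        have hk : (k : ℚ_[p]) + 1 ≠ 0 := by exact_mod_cast k.succ_ne_zero
        rw [← chooseTerm_eq_div, ← div_div, div_right_comm, mul_div_cancel₀ _ hk])
    rw [Nat.sub_add_cancel hpos, Nat.cast_sub hpos, Nat.cast_one, ← coe_chooseTerm] at hdiv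
    -- Here v = 1/(x(x+1)) and T_{p-1} = v(p²c - pt(t+1)); substitute into -2(p-1) T_{p-1} +
    -- 2pt(t+1)v and divide by p².
    refine ⟨2 * v * (t * (t + 1) - (p - 1) * c), ?_⟩
    rw [hdiv]
    have hvq : (x : ℚ_[p]) * ((x : ℚ_[p]) + 1) * v = 1 := by
      have h := congrArg (fun y : ℤ_[p] => (y : ℚ_[p])) hv
      push_cast at h
      exact h
    have hcq := congrArg (fun y : ℤ_[p] => (y : ℚ_[p])) hc
    push_cast at hcq ⊢
    have hne : (x : ℚ_[p]) * ((x : ℚ_[p]) + 1) ≠ 0 := left_ne_zero_of_mul_eq_one hvq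
    rw [div_eq_mul_inv, inv_eq_of_mul_eq_one_right hvq, h2]
    linear_combination 2 * ((p : ℚ_[p]) - 1) * ((chooseTerm x (p - 1) : ℤ_[p]) : ℚ_[p]) * hvq -
      2 * ((p : ℚ_[p]) - 1) * v * hcq
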